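/- Let $d\ge 2$ be an integer, let $0<\alpha<1$, and let $\mathbf a=(a_n)_{n=1}^\infty$ be a sequence of complex numbers with $a_n=n^{o(1)}$, that is, for every $\varepsilon>0$ one has $|a_n|\le n^{\varepsilon}$ for all sufficiently large $n$. For $\mathbf x=(x_1,\ldots,x_d)\in\mathbb R^d$ and $N\in\mathbb N$ put $$S_{\mathbf a,d}(\mathbf x;N)=\sum_{n=1}^{N}a_n\exp\bigl(2\pi i(x_1n+x_2n^2+\cdots+x_dn^d)\bigr).$$ Identify the torus $\mathsf T_d=(\mathbb R/\mathbb Z)^d$ with the half-open cube $[0,1)^d\subset\mathbb R^d$, and let $$\mathcal E_{\mathbf a,d,\alpha}=\bigl\{\mathbf x\in\mathsf T_d:\ |S_{\mathbf a,d}(\mathbf x;N)|\ge N^{\alpha}\ \text{for infinitely many } N\in\mathbb N\bigr\}.$$ Let $\Gamma=\{(t,t^2,\ldots,t^d):\ t\in[0,1]\}$ be the moment curve. Then $$\dim\bigl(\mathcal E_{\mathbf a,d,\alpha}\cap\Gamma\bigr)\le 1-\frac{2\alpha-1}{d+1-\alpha},$$ where $\dim$ denotes the Hausdorff dimension with respect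 to the Euclidean metric on $\mathbb R^d$. -/

import Mathlib

noncomputable section

/-- The condition `a_n = n^{o(1)}` on a sequence `(a_n)_{n ≥ 1}` of complex weights: for every `ε > 0`
one has `|a_n| ≤ n^ε` for all sufficiently large `n`. (The value `a 0` plays no role.) -/
def IsSubpolynomial (a : ℕ → ℂ) : Prop :=
  ∀ ε : ℝ, 0 < ε → ∀ᶠ n : ℕ in Filter.atTop, ‖a n‖ ≤ (n : ℝ) ^ ε

/-- The function `e(x) = exp(2 π i x)`. -/
def expTwoPi (x : ℝ) : ℂ :=
  Complex.exp (2 * (Real.pi : ℂ) * Complex.I * (x : ℂ))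

/-- The weighted Weyl sum `S_{a,d}(x; N) = ∑_{n=1}^N a_n e(x_1 n + ⋯ + x_d n^d)`.
The coordinates of `x` are indexed from `0`, so `x j` is the coefficient of `n ^ (j + 1)`. -/
def weylSum (a : ℕ → ℂ) (d : ℕ) (x : EuclideanSpace ℝ (Fin d)) (N : ℕ) : ℂ :=
  ∑ n ∈ Finset.Icc 1 N, a n * expTwoPi (∑ j : Fin d, x j * (n : ℝ) ^ ((j : ℕ) + 1))

/-- The torus `(ℝ/ℤ)^d`, identified with the half-open unit cube `[0,1)^d` in Euclidean space. -/
def torusCube (d : ℕ) : Set (EuclideanSpace ℝ (Fin d)) :=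
  {x | ∀ j : Fin d, x j ∈ Set.Ico (0 : ℝ) 1}

/-- The exceptional set: the points `x` of the torus such that `|S_{a,d}(x; N)| ≥ N^α` for
infinitely many `N`. -/
def exceptionalSet (a : ℕ → ℂ) (d : ℕ) (α : ℝ) : Set (EuclideanSpace ℝ (Fin d)) :=
  {x | x ∈ torusCube d ∧ {N : ℕ | (N : ℝ) ^ α ≤ ‖weylSum a d x N‖}.Infinite}

/-- The moment curve `{(t, t^2, …, t^d) : t ∈ [0,1]}`. -/
def momentCurve (d : ℕ) : Set (EuclideanSpace ℝ (Fin d)) :=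
  (fun t : ℝ => WithLp.toLp 2 (fun j : Fin d => t ^ ((j : ℕ) + 1))) '' Set.Icc (0 : ℝ) 1

end

/-! Work in the parameter `t` of the curve. For `m < n` the difference of the two phases is a
polynomial in `t` with nonnegative coefficients, so on `[0,1]` it is convex with derivative at least
`n - m`. Van der Corput's estimate bounds the correlation of the two terms by `1 / (n - m)`, so a
block of `L` terms has mean square `L` up to logarithms and the size of the weights. The
Rademacher–Menshov inequality makes this uniform over all `N ≤ X = 2 ^ K`, at logarithmic cost. If
`|S(N)| ≥ N ^ α` at `t`, with `N` comparable to `X`, the Lipschitz bound for `S` keeps it at least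
`N ^ α / 2` on an interval of length `1 / Q` containing `t`, where `Q` is about `X ^ (d + 1 - α)`.
By Chebyshev, at most about `Q * X ^ (1 - 2 * α)` of the `Q` intervals are bad. The sum over `K` of
`Q ^ (1 - s) * X ^ (1 - 2 * α)` converges once `s > 1 - (2 * α - 1) / (d + 1 - α)`, and
Hausdorff–Cantelli concludes. -/

theorem expTwoPi_zero : expTwoPi 0 = 1 := by simp [expTwoPi]

theorem norm_expTwoPi (x : ℝ) : ‖expTwoPi x‖ = 1 := by
  have : expTwoPi x = Complex.exp ((2 * Real.pi * x : ℝ) * Complex.I) := by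
    simp only [expTwoPi]; congr 1; push_cast; ring
  rw [this, Complex.norm_exp_ofReal_mul_I]

theorem expTwoPi_add (x y : ℝ) : expTwoPi (x + y) = expTwoPi x * expTwoPi y := by
  simp only [expTwoPi, ← Complex.exp_add]; congr 1; push_cast; ring

theorem conj_expTwoPi (x : ℝ) : (starRingEnd ℂ) (expTwoPi x) = expTwoPi (-x) := by
  simp only [expTwoPi, ← Complex.exp_conj]; congr 1; simp [map_ofNat]

theorem continuous_expTwoPi : Continuous expTwoPi := by
  unfold expTwoPi; fun_prop

theorem HasDerivAt.expTwoPi {g : ℝ → ℝ} {g' t : ℝ} (h : HasDerivAt g g' t) :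
    HasDerivAt (fun t => expTwoPi (g t))
      (expTwoPi (g t) * (2 * (Real.pi : ℂ) * Complex.I * (g' : ℂ))) t := by
  have := (h.ofReal_comp.const_mul (2 * (Real.pi : ℂ) * Complex.I)).cexp
  simpa only [_root_.expTwoPi] using this

theorem norm_expTwoPi_sub_le (x y : ℝ) :
    ‖expTwoPi x - expTwoPi y‖ ≤ 2 * Real.pi * |x - y| := by
  have h : ∀ z ∈ (Set.univ : Set ℝ), HasDerivWithinAt expTwoPi
      (expTwoPi z * (2 * (Real.pi : ℂ) * Complex.I * ((1 : ℝ) : ℂ))) Set.univ z := fun z _ =>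
    (HasDerivAt.expTwoPi (hasDerivAt_id z)).hasDerivWithinAt
  have := convex_univ.norm_image_sub_le_of_norm_hasDerivWithin_le (C := 2 * Real.pi) h
    (fun z _ => by simp [norm_expTwoPi, abs_of_pos Real.pi_pos]) (Set.mem_univ y) (Set.mem_univ x)
  simpa using this

/-! ### Van der Corput's estimate -/

/-- Van der Corput's first derivative estimate, for a phase with nondecreasing derivative. -/
theorem norm_integral_expTwoPi_le {g g' g'' : ℝ → ℝ} {lam : ℝ} (hlam : 0 < lam)
    (hg : ∀ t, HasDerivAt g (g' t) t) (hg' : ∀ t, HasDerivAt g' (g'' t) t)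
    (hc : Continuous g'') (hlow : ∀ t ∈ Set.Icc (0 : ℝ) 1, lam ≤ g' t)
    (hconv : ∀ t ∈ Set.Icc (0 : ℝ) 1, 0 ≤ g'' t) :
    ‖∫ t in (0 : ℝ)..1, expTwoPi (g t)‖ ≤ 1 / lam := by
  have hI : Set.uIcc (0 : ℝ) 1 = Set.Icc 0 1 := Set.uIcc_of_le zero_le_one
  have hpos : ∀ t ∈ Set.Icc (0 : ℝ) 1, 0 < g' t := fun t ht => hlam.trans_le (hlow t ht)
  have hgc : Continuous g := continuous_iff_continuousAt.2 fun t => (hg t).continuousAt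
  have hgc' : Continuous g' := continuous_iff_continuousAt.2 fun t => (hg' t).continuousAt
  -- Integration by parts: `h` is `e(g) / (2πi g')`, and `h' = e(g) - r`.
  set h : ℝ → ℂ := fun t => expTwoPi (g t) * (((2 * Real.pi)⁻¹ * (g' t)⁻¹ : ℝ) * (-Complex.I)) with hh
  set r : ℝ → ℂ := fun t => expTwoPi (g t) *
    (((2 * Real.pi)⁻¹ * (g'' t / g' t ^ 2) : ℝ) * (-Complex.I)) with hr
  have hcinv : ContinuousOn (fun t => g'' t / g' t ^ 2) (Set.Icc 0 1) :=
    hc.continuousOn.div (hgc'.pow 2).continuousOn fun t ht => pow_ne_zero _ (hpos t ht).ne'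
  have hce : Continuous fun t => expTwoPi (g t) := continuous_expTwoPi.comp hgc
  have hcr : ContinuousOn r (Set.Icc 0 1) := hce.continuousOn.mul
    ((Complex.continuous_ofReal.comp_continuousOn (continuousOn_const.mul hcinv)).mul
      continuousOn_const)
  have hinv : ∀ t ∈ Set.Icc (0 : ℝ) 1,
      HasDerivAt (fun t => (g' t)⁻¹) (-g'' t / g' t ^ 2) t := fun t ht =>
    (hg' t).inv (hpos t ht).ne'
  have hder : ∀ t ∈ Set.Icc (0 : ℝ) 1, HasDerivAt h (expTwoPi (g t) - r t) t := by
    intro t ht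
    have h1 := (hg t).expTwoPi.mul
      ((((hinv t ht).const_mul (2 * Real.pi)⁻¹).ofReal_comp).mul_const (-Complex.I))
    convert! h1 using 1
    have : (g' t : ℂ) ≠ 0 := by exact_mod_cast (hpos t ht).ne'
    simp only [hr]
    push_cast
    field_simp
    linear_combination (2 * expTwoPi (g t) * Real.pi * (g' t : ℂ) ^ 2) * Complex.I_sq
  have hint : IntervalIntegrable r MeasureTheory.volume 0 1 :=
    ContinuousOn.intervalIntegrable (by rwa [hI])
  have hinte : IntervalIntegrable (fun t => expTwoPi (g t)) MeasureTheory.volume 0 1 :=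
    hce.intervalIntegrable _ _
  have e1 := intervalIntegral.integral_eq_sub_of_hasDerivAt (f := h)
    (f' := fun t => expTwoPi (g t) - r t) (a := 0) (b := 1)
    (by rw [hI]; exact hder) (hinte.sub hint)
  rw [intervalIntegral.integral_sub hinte hint] at e1
  have e2 : ∫ t in (0 : ℝ)..1, expTwoPi (g t) = h 1 - h 0 + ∫ t in (0 : ℝ)..1, r t := by
    rw [← e1]; ring
  have e3 := intervalIntegral.integral_eq_sub_of_hasDerivAt (f := fun t => -(g' t)⁻¹)
    (f' := fun t => g'' t / g' t ^ 2) (a := 0) (b := 1)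
    (by
      rw [hI]; intro t ht
      convert! (hinv t ht).neg using 1
      ring)
    (ContinuousOn.intervalIntegrable (by rwa [hI]))
  have hnh : ∀ t ∈ Set.Icc (0 : ℝ) 1, ‖h t‖ = (2 * Real.pi)⁻¹ * (g' t)⁻¹ := by
    intro t ht
    simp only [hh, norm_mul, norm_expTwoPi, norm_neg, Complex.norm_I, mul_one, one_mul]
    rw [Complex.norm_real, Real.norm_of_nonneg]
    have := hpos t ht
    have := Real.pi_pos
    positivity
  -- Convexity makes `g'' / g' ^ 2` nonnegative, so the bound for `‖r‖` is an exact derivative. Its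
  -- value at `1` cancels the boundary term there, leaving `1 / (π * g' 0)`.
  have hnr : ‖∫ t in (0 : ℝ)..1, r t‖ ≤ (2 * Real.pi)⁻¹ * (-(g' 1)⁻¹ - -(g' 0)⁻¹) := by
    rw [← e3, ← intervalIntegral.integral_const_mul]
    refine intervalIntegral.norm_integral_le_of_norm_le zero_le_one
      (Filter.Eventually.of_forall fun t ht => ?_)
      (ContinuousOn.intervalIntegrable (by rw [hI]; exact continuousOn_const.mul hcinv))
    have ht' : t ∈ Set.Icc (0 : ℝ) 1 := Set.Ioc_subset_Icc_self ht
    simp only [hr, norm_mul, norm_expTwoPi, norm_neg, Complex.norm_I, mul_one, one_mul]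
    rw [Complex.norm_real, Real.norm_of_nonneg]
    have := hpos t ht'
    have := hconv t ht'
    have := Real.pi_pos
    positivity
  have h0 : (0 : ℝ) ∈ Set.Icc (0 : ℝ) 1 := by simp
  have h1 : (1 : ℝ) ∈ Set.Icc (0 : ℝ) 1 := by simp
  have hn := (norm_add_le (h 1 - h 0) (∫ t in (0 : ℝ)..1, r t)).trans
    (add_le_add (norm_sub_le _ _) hnr)
  rw [← e2, hnh 0 h0, hnh 1 h1] at hn
  refine hn.trans ?_
  have hi : (g' 0)⁻¹ ≤ lam⁻¹ := inv_anti₀ hlam (hlow 0 h0)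
  have hpi1 : (Real.pi)⁻¹ ≤ 1 := inv_le_one_of_one_le₀ (by linarith [Real.pi_gt_three])
  have hp0 : 0 < (g' 0)⁻¹ := inv_pos.2 (hpos 0 h0)
  calc _ = Real.pi⁻¹ * (g' 0)⁻¹ := by rw [mul_inv]; ring
    _ ≤ 1 * lam⁻¹ := by gcongr
    _ = 1 / lam := by ring

/-! ### Near-orthogonality along the curve -/

/-- The phase of the `n`-th term of the Weyl sum along the moment curve. -/
noncomputable def curvePhase (d n : ℕ) (t : ℝ) : ℝ := ∑ j : Fin d, t ^ ((j : ℕ) + 1) * (n : ℝ) ^ ((j : ℕ) + 1)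

theorem continuous_curvePhase (d n : ℕ) : Continuous (curvePhase d n) := by
  unfold curvePhase; fun_prop

/-- The coefficients `n ^ (j + 1) - m ^ (j + 1)` are all nonnegative, so the phase difference is
convex on `[0,1]`, and its linear term alone forces derivative at least `n - m`. -/
theorem norm_integral_curvePhase_sub_le_of_lt {d : ℕ} (hd : 0 < d) {m n : ℕ} (h : m < n) :
    ‖∫ t in (0 : ℝ)..1, expTwoPi (curvePhase d n t - curvePhase d m t)‖ ≤ 1 / ((n : ℝ) - m) := by
  have hmn : (m : ℝ) < n := by exact_mod_cast h
  set c : Fin d → ℝ := fun j => (n : ℝ) ^ ((j : ℕ) + 1) - (m : ℝ) ^ ((j : ℕ) + 1) with hcdef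
  have hc0 : ∀ j, 0 ≤ c j := fun j =>
    sub_nonneg.2 (pow_le_pow_left₀ (Nat.cast_nonneg m) hmn.le _)
  refine norm_integral_expTwoPi_le (sub_pos.2 hmn)
    (g' := fun t => ∑ j : Fin d, (((j : ℕ) + 1 : ℕ) : ℝ) * t ^ (j : ℕ) * c j)
    (g'' := fun t => ∑ j : Fin d, (((j : ℕ) + 1 : ℕ) : ℝ) * (((j : ℕ) : ℝ) * t ^ ((j : ℕ) - 1)) * c j)
    (fun t => ?_) (fun t => ?_) (by fun_prop) (fun t ht => ?_) (fun t ht => ?_)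
  · have : (fun t => curvePhase d n t - curvePhase d m t)
        = fun t => ∑ j : Fin d, t ^ ((j : ℕ) + 1) * c j := by
      funext t
      simp only [curvePhase, hcdef, ← Finset.sum_sub_distrib, mul_sub]
    rw [this]
    exact HasDerivAt.fun_sum fun j _ => by
      simpa using (hasDerivAt_pow ((j : ℕ) + 1) t).mul_const (c j)
  · exact HasDerivAt.fun_sum fun j _ =>
      ((hasDerivAt_pow (j : ℕ) t).const_mul (((j : ℕ) + 1 : ℕ) : ℝ)).mul_const (c j)
  · have := Finset.single_le_sum (f := fun j : Fin d => (((j : ℕ) + 1 : ℕ) : ℝ) * t ^ (j : ℕ) * c j)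
      (fun j _ => mul_nonneg (mul_nonneg (Nat.cast_nonneg _) (pow_nonneg ht.1 _)) (hc0 j))
      (Finset.mem_univ (⟨0, hd⟩ : Fin d))
    simpa [hcdef] using this
  · exact Finset.sum_nonneg fun j _ => mul_nonneg (mul_nonneg (Nat.cast_nonneg _)
      (mul_nonneg (Nat.cast_nonneg _) (pow_nonneg ht.1 _))) (hc0 j)

theorem norm_integral_expTwoPi_neg (g : ℝ → ℝ) :
    ‖∫ t in (0 : ℝ)..1, expTwoPi (-g t)‖ = ‖∫ t in (0 : ℝ)..1, expTwoPi (g t)‖ := by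
  simp only [← conj_expTwoPi, intervalIntegral.integral_of_le zero_le_one, integral_conj]
  exact RCLike.norm_conj _

/-- The weight bounding the correlation of two terms of the Weyl sum. -/
noncomputable def correlationBound (n m : ℕ) : ℝ := if n = m then 1 else 1 / |(n : ℝ) - m|

theorem norm_integral_curvePhase_sub_le {d : ℕ} (hd : 0 < d) (n m : ℕ) :
    ‖∫ t in (0 : ℝ)..1, expTwoPi (curvePhase d n t - curvePhase d m t)‖
      ≤ correlationBound n m := by
  unfold correlationBound
  rcases lt_trichotomy n m with h | h | h
  · rw [if_neg h.ne, abs_sub_comm, abs_of_pos (sub_pos.2 (by exact_mod_cast h)),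
      ← norm_integral_expTwoPi_neg]
    simpa only [neg_sub] using norm_integral_curvePhase_sub_le_of_lt hd h
  · simp [h, expTwoPi_zero]
  · rw [if_neg h.ne', abs_of_pos (sub_pos.2 (by exact_mod_cast h))]
    exact norm_integral_curvePhase_sub_le_of_lt hd h

/-- The diagonal gives `1`; each side of it is a harmonic sum of at most `2 ^ K` terms, hence at
most `1 + K`. -/
theorem sum_correlationBound_le {K u L n : ℕ} (hL : L ≤ 2 ^ K) (hn : n ∈ Finset.Ico u (u + L)) :
    ∑ m ∈ Finset.Ico u (u + L), correlationBound n m ≤ 3 + 2 * (K : ℝ) := by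
  obtain ⟨h1, h2⟩ := Finset.mem_Ico.1 hn
  have hharm : ∀ M ≤ L, ∑ i ∈ Finset.range M, ((i : ℝ) + 1)⁻¹ ≤ 1 + (K : ℝ) := by
    intro M hM
    have h := harmonic_le_one_add_log M
    have e : ((harmonic M : ℚ) : ℝ) = ∑ i ∈ Finset.range M, ((i : ℝ) + 1)⁻¹ := by
      simp [harmonic]
    rw [e] at h
    refine h.trans ?_
    rcases Nat.eq_zero_or_pos M with rfl | hM0
    · simp
    have hM2 : (M : ℝ) ≤ 2 ^ K := by exact_mod_cast hM.trans hL
    have := Real.log_le_log (by exact_mod_cast hM0) hM2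
    rw [Real.log_pow] at this
    nlinarith [Real.log_two_lt_d9, (Nat.cast_nonneg K : (0 : ℝ) ≤ K)]
  rw [← Finset.sum_Ico_consecutive _ h1 h2.le, Finset.sum_eq_sum_Ico_succ_bot h2]
  have hA : ∑ m ∈ Finset.Ico u n, correlationBound n m
      = ∑ i ∈ Finset.range (n - u), ((i : ℝ) + 1)⁻¹ := by
    rw [Finset.sum_Ico_eq_sum_range, ← Finset.sum_range_reflect]
    refine Finset.sum_congr rfl fun i hi => ?_
    have hi := Finset.mem_range.1 hi
    have : n = u + (n - u - 1 - i) + (i + 1) := by omega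
    have hne : n ≠ u + (n - u - 1 - i) := by omega
    rw [correlationBound, if_neg hne, one_div]
    congr 1
    have h3 : (n : ℝ) = ((u + (n - u - 1 - i) : ℕ) : ℝ) + ((i : ℝ) + 1) := by exact_mod_cast this
    rw [h3, add_sub_cancel_left, abs_of_pos (by positivity)]
  have hB : ∑ m ∈ Finset.Ico (n + 1) (u + L), correlationBound n m
      = ∑ i ∈ Finset.range (u + L - (n + 1)), ((i : ℝ) + 1)⁻¹ := by
    rw [Finset.sum_Ico_eq_sum_range]
    refine Finset.sum_congr rfl fun i _ => ?_
    rw [correlationBound, if_neg (by omega), one_div]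
    congr 1
    rw [abs_sub_comm]; push_cast
    rw [show (n : ℝ) + 1 + i - n = i + 1 by ring, abs_of_pos (by positivity)]
  rw [hA, hB]
  have h3 := hharm (n - u) (by omega)
  have h4 := hharm (u + L - (n + 1)) (by omega)
  have h5 : correlationBound n n = 1 := if_pos rfl
  linarith

/-- The terms of the Weyl sum along the moment curve. -/
noncomputable def curveTerm (a : ℕ → ℂ) (d n : ℕ) (t : ℝ) : ℂ := a n * expTwoPi (curvePhase d n t)

theorem continuous_curveTerm (a : ℕ → ℂ) (d n : ℕ) : Continuous (curveTerm a d n) :=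
  continuous_const.mul (continuous_expTwoPi.comp (continuous_curvePhase d n))

/-- Mean square of a block of the Weyl sum along the moment curve. -/
theorem integral_norm_sq_sum_curveTerm_le {d : ℕ} (hd : 0 < d) {a : ℕ → ℂ} {A : ℝ} {K u L : ℕ}
    (hA : ∀ n ∈ Finset.Ico u (u + L), ‖a n‖ ≤ A) (hL : L ≤ 2 ^ K) :
    ∫ t in (0 : ℝ)..1, ‖∑ n ∈ Finset.Ico u (u + L), curveTerm a d n t‖ ^ 2
      ≤ A ^ 2 * (3 + 2 * K) * L := by
  have e : ∀ t : ℝ, ((‖∑ n ∈ Finset.Ico u (u + L), curveTerm a d n t‖ ^ 2 : ℝ) : ℂ)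
      = ∑ n ∈ Finset.Ico u (u + L), ∑ m ∈ Finset.Ico u (u + L),
        a n * (starRingEnd ℂ) (a m) * expTwoPi (curvePhase d n t - curvePhase d m t) := by
    intro t
    rw [← Complex.normSq_eq_norm_sq, ← Complex.mul_conj, map_sum, Finset.sum_mul_sum]
    refine Finset.sum_congr rfl fun n _ => Finset.sum_congr rfl fun m _ => ?_
    simp only [curveTerm, map_mul, conj_expTwoPi, sub_eq_add_neg, expTwoPi_add]
    ring
  have hcont : ∀ n m, Continuous fun t => a n * (starRingEnd ℂ) (a m) *
      expTwoPi (curvePhase d n t - curvePhase d m t) := fun n m =>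
    continuous_const.mul (continuous_expTwoPi.comp
      ((continuous_curvePhase d n).sub (continuous_curvePhase d m)))
  have hI : ((∫ t in (0 : ℝ)..1, ‖∑ n ∈ Finset.Ico u (u + L), curveTerm a d n t‖ ^ 2 : ℝ) : ℂ)
      = ∑ n ∈ Finset.Ico u (u + L), ∑ m ∈ Finset.Ico u (u + L),
        a n * (starRingEnd ℂ) (a m) *
          ∫ t in (0 : ℝ)..1, expTwoPi (curvePhase d n t - curvePhase d m t) := by
    rw [← intervalIntegral.integral_ofReal]
    simp only [e]
    rw [intervalIntegral.integral_finsetSum fun n _ =>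
      (continuous_finsetSum _ fun m _ => hcont n m).intervalIntegrable _ _]
    refine Finset.sum_congr rfl fun n _ => ?_
    rw [intervalIntegral.integral_finsetSum fun m _ => (hcont n m).intervalIntegrable _ _]
    exact Finset.sum_congr rfl fun m _ => intervalIntegral.integral_const_mul _ _
  refine (le_abs_self _).trans ?_
  rw [← Real.norm_eq_abs, ← Complex.norm_real, hI]
  calc _ ≤ ∑ n ∈ Finset.Ico u (u + L), ∑ m ∈ Finset.Ico u (u + L), A ^ 2 * correlationBound n m := by
        refine (norm_sum_le _ _).trans (Finset.sum_le_sum fun n hn => ?_)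
        refine (norm_sum_le _ _).trans (Finset.sum_le_sum fun m hm => ?_)
        rw [norm_mul, norm_mul, RCLike.norm_conj, sq]
        have h1 := hA n hn
        have h2 := hA m hm
        have h3 := norm_integral_curvePhase_sub_le hd n m
        have h4 : 0 ≤ A := (norm_nonneg _).trans h1
        gcongr
    _ ≤ ∑ n ∈ Finset.Ico u (u + L), A ^ 2 * (3 + 2 * K) := by
        refine Finset.sum_le_sum fun n hn => ?_
        rw [← Finset.mul_sum]
        exact mul_le_mul_of_nonneg_left (sum_correlationBound_le hL hn) (sq_nonneg A)
    _ = A ^ 2 * (3 + 2 * K) * L := by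
        rw [Finset.sum_const, Nat.card_Ico, add_tsub_cancel_left, nsmul_eq_mul]; ring

/-! ### Rademacher–Menshov inequality -/

/-- The sum of `‖∑ n ∈ I, c n‖ ^ 2` over the dyadic subintervals `I` of `[u, u + 2 ^ k)`. -/
noncomputable def dyadicSquareSum (c : ℕ → ℂ) : ℕ → ℕ → ℝ
  | 0, u => ‖∑ n ∈ Finset.Ico u (u + 1), c n‖ ^ 2
  | k + 1, u => ‖∑ n ∈ Finset.Ico u (u + 2 ^ (k + 1)), c n‖ ^ 2
      + (dyadicSquareSum c k u + dyadicSquareSum c k (u + 2 ^ k))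

theorem dyadicSquareSum_nonneg (c : ℕ → ℂ) : ∀ k u, 0 ≤ dyadicSquareSum c k u
  | 0, u => by unfold dyadicSquareSum; positivity
  | k + 1, u => by
    have := dyadicSquareSum_nonneg c k u
    have := dyadicSquareSum_nonneg c k (u + 2 ^ k)
    unfold dyadicSquareSum; positivity

theorem norm_sq_sum_le_dyadicSquareSum (c : ℕ → ℂ) (k u : ℕ) :
    ‖∑ n ∈ Finset.Ico u (u + 2 ^ k), c n‖ ^ 2 ≤ dyadicSquareSum c k u := by
  cases k with
  | zero => simp [dyadicSquareSum]
  | succ k =>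
    have := dyadicSquareSum_nonneg c k u
    have := dyadicSquareSum_nonneg c k (u + 2 ^ k)
    rw [dyadicSquareSum]; linarith

/-- The Rademacher–Menshov inequality in pointwise form. -/
theorem norm_sq_partial_sum_le (c : ℕ → ℂ) (k : ℕ) : ∀ u N : ℕ, N ≤ 2 ^ k →
    ‖∑ n ∈ Finset.Ico u (u + N), c n‖ ^ 2 ≤ (k + 1) * dyadicSquareSum c k u := by
  induction k with
  | zero =>
    intro u N hN
    have : N = 0 ∨ N = 1 := by simp at hN; omega
    rcases this with rfl | rfl
    · simpa using dyadicSquareSum_nonneg c 0 u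
    · simp [dyadicSquareSum]
  | succ k ih =>
    intro u N hN
    have p1 := dyadicSquareSum_nonneg c k u
    have p2 := dyadicSquareSum_nonneg c k (u + 2 ^ k)
    have hle : ((k : ℝ) + 1 + 1) * (dyadicSquareSum c k u + dyadicSquareSum c k (u + 2 ^ k))
        ≤ (((k + 1 : ℕ) : ℝ) + 1) * dyadicSquareSum c (k + 1) u := by
      push_cast
      refine mul_le_mul_of_nonneg_left ?_ (by positivity)
      rw [dyadicSquareSum]
      linarith [sq_nonneg ‖∑ n ∈ Finset.Ico u (u + 2 ^ (k + 1)), c n‖]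
    refine le_trans ?_ hle
    rcases le_total N (2 ^ k) with h | h
    · have := ih u N h
      nlinarith [(Nat.cast_nonneg k : (0 : ℝ) ≤ k)]
    -- Past the midpoint, the left half is a complete dyadic block and costs no factor; only the
    -- right remainder uses induction.
    · have h1 := ih (u + 2 ^ k) (N - 2 ^ k) (by rw [pow_succ] at hN; omega)
      have h2 := norm_sq_sum_le_dyadicSquareSum c k u
      rw [show u + 2 ^ k + (N - 2 ^ k) = u + N by omega] at h1
      rw [← Finset.sum_Ico_consecutive c (show u ≤ u + 2 ^ k by omega)
        (show u + 2 ^ k ≤ u + N by omega)]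
      set x := ∑ n ∈ Finset.Ico u (u + 2 ^ k), c n
      set y := ∑ n ∈ Finset.Ico (u + 2 ^ k) (u + N), c n
      have h3 : ‖x + y‖ ^ 2 ≤ (‖x‖ + ‖y‖) ^ 2 := by gcongr; exact norm_add_le x y
      have hk : (0 : ℝ) < k + 1 := by positivity
      -- Weighted Cauchy–Schwarz with weights `1` and `1 / (k + 1)`; this keeps the constant linear
      -- in `k`.
      have h4 : (k + 1 : ℝ) * (‖x‖ + ‖y‖) ^ 2
          ≤ (k + 1 + 1) * ((k + 1) * ‖x‖ ^ 2 + ‖y‖ ^ 2) := by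
        nlinarith [sq_nonneg ((k + 1 : ℝ) * ‖x‖ - ‖y‖)]
      have h5 : (k + 1 : ℝ) * ‖x‖ ^ 2 + ‖y‖ ^ 2
          ≤ (k + 1) * (dyadicSquareSum c k u + dyadicSquareSum c k (u + 2 ^ k)) := by
        nlinarith
      have h6 : (k + 1 : ℝ) * (‖x‖ + ‖y‖) ^ 2 ≤ (k + 1) *
          ((k + 1 + 1) * (dyadicSquareSum c k u + dyadicSquareSum c k (u + 2 ^ k))) := by
        refine h4.trans ?_
        calc _ ≤ (k + 1 + 1 : ℝ) * ((k + 1) *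
            (dyadicSquareSum c k u + dyadicSquareSum c k (u + 2 ^ k))) :=
              mul_le_mul_of_nonneg_left h5 (by positivity)
          _ = _ := by ring
      exact h3.trans (le_of_mul_le_mul_left h6 hk)

theorem continuous_dyadicSquareSum {c : ℕ → ℝ → ℂ} (hc : ∀ n, Continuous (c n)) (k : ℕ) :
    ∀ u, Continuous fun t => dyadicSquareSum (fun n => c n t) k u := by
  induction k with
  | zero => intro u; unfold dyadicSquareSum; fun_prop
  | succ k ih =>
    intro u
    have := ih u
    have := ih (u + 2 ^ k)
    unfold dyadicSquareSum; fun_prop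

/-- Each of the `k + 1` dyadic levels has total length `2 ^ k`. Blocks start at `1 + u`, so index
`0` never enters. -/
theorem integral_dyadicSquareSum_le {c : ℕ → ℝ → ℂ} (hc : ∀ n, Continuous (c n)) {M : ℝ} {V : ℕ}
    (h : ∀ u L, u + L ≤ V →
      ∫ t in (0 : ℝ)..1, ‖∑ n ∈ Finset.Ico (1 + u) (1 + u + L), c n t‖ ^ 2 ≤ M * L) (k : ℕ) :
    ∀ u, u + 2 ^ k ≤ V →
      ∫ t in (0 : ℝ)..1, dyadicSquareSum (fun n => c n t) k (1 + u) ≤ M * ((k + 1) * 2 ^ k) := by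
  induction k with
  | zero =>
    intro u hu
    simpa [dyadicSquareSum] using h u 1 (by simpa using hu)
  | succ k ih =>
    intro u hu
    have hp : 2 ^ (k + 1) = 2 ^ k + 2 ^ k := by ring
    have hp0 : 0 < 2 ^ k := by positivity
    have h1 := ih u (by omega)
    have h2 := ih (u + 2 ^ k) (by omega)
    have h3 := h u (2 ^ (k + 1)) hu
    simp only [dyadicSquareSum]
    have c1 := continuous_dyadicSquareSum hc k (1 + u)
    have c2 := continuous_dyadicSquareSum hc k (1 + u + 2 ^ k)
    rw [intervalIntegral.integral_add, intervalIntegral.integral_add (c1.intervalIntegrable _ _)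
      (c2.intervalIntegrable _ _)]
    · rw [← add_assoc] at h2
      push_cast at h3 ⊢
      refine (add_le_add h3 (add_le_add h1 h2)).trans (le_of_eq ?_)
      ring
    · exact Continuous.intervalIntegrable (by fun_prop) _ _
    · exact (c1.add c2).intervalIntegrable _ _

/-! ### Discretisation and covering -/

/-- On `[0,1]` each of the `N` phases is Lipschitz with constant `d ^ 2 * N ^ d`. -/
theorem norm_sum_curveTerm_sub_le {d N : ℕ} {a : ℕ → ℂ} {A s t : ℝ}
    (hA : ∀ n ∈ Finset.Ico 1 (1 + N), ‖a n‖ ≤ A)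
    (hs : s ∈ Set.Icc (0 : ℝ) 1) (ht : t ∈ Set.Icc (0 : ℝ) 1) :
    ‖∑ n ∈ Finset.Ico 1 (1 + N), curveTerm a d n s - ∑ n ∈ Finset.Ico 1 (1 + N), curveTerm a d n t‖
      ≤ A * (2 * Real.pi * d ^ 2) * (N : ℝ) ^ (d + 1) * |s - t| := by
  have hphase : ∀ n ∈ Finset.Ico 1 (1 + N),
      |curvePhase d n s - curvePhase d n t| ≤ d ^ 2 * (N : ℝ) ^ d * |s - t| := by
    intro n hn
    obtain ⟨h1, h2⟩ := Finset.mem_Ico.1 hn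
    have hnN : (n : ℝ) ≤ N := by exact_mod_cast (by omega : n ≤ N)
    have hN1 : (1 : ℝ) ≤ N := by exact_mod_cast (by omega : 1 ≤ N)
    simp only [curvePhase, ← Finset.sum_sub_distrib, ← sub_mul]
    calc _ ≤ ∑ j : Fin d, |(s ^ ((j : ℕ) + 1) - t ^ ((j : ℕ) + 1)) * (n : ℝ) ^ ((j : ℕ) + 1)| :=
          Finset.abs_sum_le_sum_abs _ _
      _ ≤ ∑ _j : Fin d, (|s - t| * d * 1) * (N : ℝ) ^ d := by
          refine Finset.sum_le_sum fun j _ => ?_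
          rw [abs_mul, abs_of_nonneg (pow_nonneg (Nat.cast_nonneg n) _ : (0 : ℝ) ≤ (n : ℝ) ^ ((j : ℕ) + 1))]
          have hj : (((j : ℕ) + 1 : ℕ) : ℝ) ≤ d := by exact_mod_cast j.2
          have hm : max |s| |t| ≤ 1 := by
            rw [abs_of_nonneg hs.1, abs_of_nonneg ht.1]; exact max_le hs.2 ht.2
          have hp : (n : ℝ) ^ ((j : ℕ) + 1) ≤ (N : ℝ) ^ d :=
            (pow_le_pow_left₀ (Nat.cast_nonneg n) hnN _).trans (pow_le_pow_right₀ hN1 j.2)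
          refine mul_le_mul ((abs_pow_sub_pow_le s t _).trans ?_) hp (by positivity) (by positivity)
          have hm' : max |s| |t| ^ ((j : ℕ) + 1 - 1) ≤ 1 :=
            pow_le_one₀ (le_max_of_le_left (abs_nonneg s)) hm
          gcongr
      _ = d ^ 2 * (N : ℝ) ^ d * |s - t| := by
          rw [Finset.sum_const, Finset.card_univ, Fintype.card_fin, nsmul_eq_mul]; ring
  rw [← Finset.sum_sub_distrib]
  calc _ ≤ ∑ n ∈ Finset.Ico 1 (1 + N), A * (2 * Real.pi * (d ^ 2 * (N : ℝ) ^ d * |s - t|)) := by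
        refine (norm_sum_le _ _).trans (Finset.sum_le_sum fun n hn => ?_)
        rw [curveTerm, curveTerm, ← mul_sub, norm_mul]
        have h1 := hA n hn
        have h2 : 0 ≤ A := (norm_nonneg _).trans h1
        refine mul_le_mul h1 ((norm_expTwoPi_sub_le _ _).trans ?_) (norm_nonneg _) h2
        exact mul_le_mul_of_nonneg_left (hphase n hn) (by positivity)
    _ = _ := by
        rw [Finset.sum_const, Nat.card_Ico, add_tsub_cancel_left, nsmul_eq_mul]; ring

/-- Chebyshev's inequality for a partition of the unit interval into `Q` equal parts. -/
theorem card_mul_le_mul_integral {F : ℝ → ℝ} (hF : Continuous F) (hF0 : ∀ t, 0 ≤ F t) {Q : ℕ}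
    (hQ : 0 < Q) {G : Finset ℕ} (hG : G ⊆ Finset.range Q) {lam : ℝ}
    (hlam : ∀ j ∈ G, ∀ t ∈ Set.Icc ((j : ℝ) / Q) (((j : ℝ) + 1) / Q), lam ≤ F t) :
    G.card * lam ≤ Q * ∫ t in (0 : ℝ)..1, F t := by
  have hQ' : (0 : ℝ) < Q := by exact_mod_cast hQ
  have hle : ∀ j : ℕ, (j : ℝ) / Q ≤ ((j : ℝ) + 1) / Q := fun j => by gcongr; linarith
  have e := intervalIntegral.sum_integral_adjacent_intervals (f := F) (μ := MeasureTheory.volume)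
    (a := fun k : ℕ => (k : ℝ) / Q) (n := Q) (fun k _ => hF.intervalIntegrable _ _)
  simp only [Nat.cast_zero, zero_div, div_self hQ'.ne', Nat.cast_add, Nat.cast_one] at e
  rw [← e]
  have h1 : ∑ j ∈ G, lam / Q ≤ ∑ j ∈ Finset.range Q, ∫ t in ((j : ℝ) / Q)..(((j : ℝ) + 1) / Q), F t := by
    refine (Finset.sum_le_sum fun j hj => ?_).trans (Finset.sum_le_sum_of_subset_of_nonneg hG
      fun j _ _ => intervalIntegral.integral_nonneg (hle j) fun t _ => hF0 t)
    have h2 := intervalIntegral.integral_mono_on (hle j) (f := fun _ => lam) (g := F)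
      intervalIntegrable_const (hF.intervalIntegrable (μ := MeasureTheory.volume) _ _) (hlam j hj)
    refine le_trans (le_of_eq ?_) h2
    rw [intervalIntegral.integral_const, smul_eq_mul, ← sub_div, add_sub_cancel_left]
    ring
  rw [Finset.sum_const, nsmul_eq_mul] at h1
  calc (G.card : ℝ) * lam = Q * (G.card * (lam / Q)) := by field_simp
    _ ≤ _ := mul_le_mul_of_nonneg_left h1 hQ'.le

/-- The Hausdorff–Cantelli lemma for families of intervals of length `1 / Q k`. -/
theorem dimH_le_of_summable_cover {T : Set ℝ} {s : NNReal} {Q : ℕ → ℕ} {G : ℕ → Finset ℕ}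
    (hQ : ∀ k, 2 ^ k ≤ Q k)
    (hT : ∀ t ∈ T, ∀ n, ∃ k ≥ n, ∃ j ∈ G k, t ∈ Set.Icc ((j : ℝ) / Q k) (((j : ℝ) + 1) / Q k))
    (hsum : Summable fun k => ((G k).card : ℝ) * (1 / (Q k : ℝ)) ^ (s : ℝ)) :
    dimH T ≤ s := by
  refine dimH_le_of_hausdorffMeasure_ne_top (ne_of_lt (lt_of_le_of_lt ?_ ENNReal.zero_lt_top))
  have hdiam : ∀ (k j : ℕ), Metric.ediam (Set.Icc ((j : ℝ) / Q k) (((j : ℝ) + 1) / Q k))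
      = ENNReal.ofReal (1 / (Q k : ℝ)) := by
    intro k j
    rw [Real.ediam_Icc, ← sub_div, add_sub_cancel_left]
  have hQ0 : ∀ k, (0 : ℝ) < 1 / (Q k : ℝ) := fun k => by
    have : 0 < Q k := lt_of_lt_of_le (by positivity) (hQ k)
    positivity
  set f : ℕ → ENNReal := fun k => ENNReal.ofReal (((G k).card : ℝ) * (1 / (Q k : ℝ)) ^ (s : ℝ))
  have hf : ∑' k, f k ≠ ⊤ := hsum.tsum_ofReal_ne_top
  have hlim := ENNReal.tendsto_sum_nat_add f hf
  have hr : Filter.Tendsto (fun n : ℕ => ENNReal.ofReal ((1 / 2 : ℝ) ^ n)) Filter.atTop (nhds 0) := by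
    have := tendsto_pow_atTop_nhds_zero_of_lt_one (r := (1 / 2 : ℝ)) (by norm_num) (by norm_num)
    simpa using ENNReal.tendsto_ofReal this
  -- The `n`-th cover uses only scales `k ≥ n`; its cost is a tail of the convergent series.
  refine (MeasureTheory.Measure.hausdorffMeasure_le_liminf_tsum (β := ℕ)
    (ι := fun n => Σ k : ℕ, {j // j ∈ G (k + n)}) (l := Filter.atTop) (s : ℝ) T _ hr
    (fun n i => Set.Icc ((i.2.1 : ℝ) / Q (i.1 + n)) (((i.2.1 : ℝ) + 1) / Q (i.1 + n)))
    (Filter.Eventually.of_forall fun n i => ?_) (Filter.Eventually.of_forall fun n t ht => ?_)).trans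
      ?_
  · rw [hdiam]
    refine ENNReal.ofReal_le_ofReal ?_
    rw [one_div_pow]
    refine one_div_le_one_div_of_le (by positivity) ?_
    have : 2 ^ n ≤ Q (i.1 + n) :=
      (Nat.pow_le_pow_right (by norm_num) (Nat.le_add_left _ _)).trans (hQ _)
    exact_mod_cast this
  · obtain ⟨k, hk, j, hj, hm⟩ := hT t ht n
    obtain ⟨l, rfl⟩ := Nat.exists_eq_add_of_le' hk
    exact Set.mem_iUnion.2 ⟨⟨l, j, hj⟩, hm⟩
  · refine le_of_eq (Filter.Tendsto.liminf_eq ?_)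
    convert! hlim using 2 with n
    rw [ENNReal.tsum_sigma']
    refine tsum_congr fun k => ?_
    simp only [hdiam]
    rw [ENNReal.tsum_const, ENat.card_eq_coe_fintype_card, Fintype.card_coe]
    simp only [f]
    rw [ENNReal.ofReal_rpow_of_pos (hQ0 _), ENNReal.ofReal_mul (by positivity), ENNReal.ofReal_natCast]
    simp

theorem IsSubpolynomial.exists_const {a : ℕ → ℂ} (ha : IsSubpolynomial a) {ε : ℝ} (hε : 0 < ε) :
    ∃ C : ℝ, 1 ≤ C ∧ ∀ n : ℕ, 1 ≤ n → ‖a n‖ ≤ C * (n : ℝ) ^ ε := by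
  obtain ⟨n₀, h⟩ := Filter.eventually_atTop.1 (ha ε hε)
  have h0 : 0 ≤ ∑ n ∈ Finset.range n₀, ‖a n‖ := Finset.sum_nonneg fun _ _ => norm_nonneg _
  refine ⟨1 + ∑ n ∈ Finset.range n₀, ‖a n‖, by linarith, fun n hn => ?_⟩
  have hn1 : 1 ≤ (n : ℝ) ^ ε := Real.one_le_rpow (by exact_mod_cast hn) hε.le
  rcases le_or_gt n₀ n with hle | hlt
  · nlinarith [h n hle]
  · have := Finset.single_le_sum (f := fun n => ‖a n‖) (fun _ _ => norm_nonneg _)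
      (Finset.mem_range.2 hlt)
    nlinarith

/-! ### Counting bad intervals -/

/-- The indices of the intervals `[j / Q, (j + 1) / Q]` throughout which the dyadic square sum of
length `2 ^ K` is at least `lam`. -/
noncomputable def largeIntervals (a : ℕ → ℂ) (d K Q : ℕ) (lam : ℝ) : Finset ℕ := by
  classical
  exact (Finset.range Q).filter fun j => ∀ t ∈ Set.Icc ((j : ℝ) / Q) (((j : ℝ) + 1) / Q),
    lam ≤ dyadicSquareSum (fun n => curveTerm a d n t) K 1

theorem mem_largeIntervals {a : ℕ → ℂ} {d K Q : ℕ} {lam : ℝ} {j : ℕ} :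
    j ∈ largeIntervals a d K Q lam ↔ j < Q ∧
      ∀ t ∈ Set.Icc ((j : ℝ) / Q) (((j : ℝ) + 1) / Q),
        lam ≤ dyadicSquareSum (fun n => curveTerm a d n t) K 1 := by
  simp [largeIntervals]

theorem card_largeIntervals_mul_le {a : ℕ → ℂ} {d K Q : ℕ} (hd : 0 < d) (hQ : 0 < Q) {A : ℝ}
    (hA : ∀ n, 1 ≤ n → n ≤ 2 ^ K → ‖a n‖ ≤ A) (lam : ℝ) :
    (largeIntervals a d K Q lam).card * lam
      ≤ Q * (A ^ 2 * (3 + 2 * K) * ((K + 1) * 2 ^ K)) := by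
  have hc := continuous_curveTerm a d
  refine (card_mul_le_mul_integral (continuous_dyadicSquareSum hc K 1)
    (fun t => dyadicSquareSum_nonneg _ _ _) hQ
    (fun j hj => Finset.mem_range.2 (mem_largeIntervals.1 hj).1)
    (fun j hj => (mem_largeIntervals.1 hj).2)).trans
    (mul_le_mul_of_nonneg_left ?_ (Nat.cast_nonneg Q))
  refine integral_dyadicSquareSum_le hc (V := 2 ^ K) (fun u L hu => ?_) K 0 (by simp)
  refine integral_norm_sq_sum_curveTerm_le hd (fun n hn => ?_) (by omega)
  obtain ⟨h1, h2⟩ := Finset.mem_Ico.1 hn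
  exact hA n (by omega) (by omega)

/-- If the sum over `[1, N]` is large at a point, the dyadic square sum is large on a whole
interval around it. -/
theorem exists_mem_largeIntervals {a : ℕ → ℂ} {d K Q N : ℕ} {A α t : ℝ} (hA0 : 0 ≤ A)
    (hα0 : 0 ≤ α) (hα1 : α ≤ 1)
    (hA : ∀ n, 1 ≤ n → n ≤ 2 ^ K → ‖a n‖ ≤ A) (hQ : 0 < Q)
    (hQA : 4 * Real.pi * d ^ 2 * A * ((2 : ℝ) ^ K) ^ ((d : ℝ) + 1 - α) ≤ Q)
    (hN1 : 1 ≤ N) (hN : N ≤ 2 ^ K) (hN2 : 2 ^ K ≤ 2 * N) (ht : t ∈ Set.Ico (0 : ℝ) 1)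
    (hlarge : (N : ℝ) ^ α ≤ ‖∑ n ∈ Finset.Ico 1 (1 + N), curveTerm a d n t‖) :
    ∃ j ∈ largeIntervals a d K Q (((2 : ℝ) ^ K) ^ (2 * α) / (16 * (K + 1))),
      t ∈ Set.Icc ((j : ℝ) / Q) (((j : ℝ) + 1) / Q) := by
  have hQ' : (0 : ℝ) < Q := by exact_mod_cast hQ
  have hN1' : (1 : ℝ) ≤ N := by exact_mod_cast hN1
  have hN0 : (0 : ℝ) < N := by linarith
  have hNK : (N : ℝ) ≤ 2 ^ K := by exact_mod_cast hN
  have hNK2 : (2 : ℝ) ^ K ≤ 2 * N := by exact_mod_cast hN2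
  have hjQ : ⌊t * Q⌋₊ < Q := by
    refine (Nat.floor_lt (mul_nonneg ht.1 hQ'.le)).2 ?_
    nlinarith [ht.2]
  have hmem : t ∈ Set.Icc ((⌊t * Q⌋₊ : ℝ) / Q) (((⌊t * Q⌋₊ : ℝ) + 1) / Q) :=
    ⟨(div_le_iff₀ hQ').2 (Nat.floor_le (mul_nonneg ht.1 hQ'.le)),
      (le_div_iff₀ hQ').2 (Nat.lt_floor_add_one _).le⟩
  refine ⟨⌊t * Q⌋₊, mem_largeIntervals.2 ⟨hjQ, fun t' ht' => ?_⟩, hmem⟩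
  have ht'1 : t' ∈ Set.Icc (0 : ℝ) 1 := by
    refine ⟨le_trans (by positivity) ht'.1, ht'.2.trans ((div_le_one hQ').2 ?_)⟩
    exact_mod_cast hjQ
  have hdist : |t - t'| ≤ 1 / Q := by
    have h := Real.dist_le_of_mem_Icc hmem ht'
    rw [Real.dist_eq] at h
    refine h.trans (le_of_eq ?_)
    rw [← sub_div, add_sub_cancel_left]
  have hdiff := norm_sum_curveTerm_sub_le (d := d) (a := a) (N := N) (A := A)
    (fun n hn => hA n (Finset.mem_Ico.1 hn).1 (by have := Finset.mem_Ico.1 hn; omega))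
    (Set.Ico_subset_Icc_self ht) ht'1
  -- The size of `Q` is dictated here: the oscillation over one interval is at most half of `N ^ α`.
  have hsmall : A * (2 * Real.pi * d ^ 2) * (N : ℝ) ^ (d + 1) * |t - t'| ≤ (N : ℝ) ^ α / 2 := by
    have hpow : (N : ℝ) ^ (d + 1) = (N : ℝ) ^ ((d : ℝ) + 1 - α) * (N : ℝ) ^ α := by
      rw [← Real.rpow_add hN0, ← Real.rpow_natCast]; congr 1; push_cast; ring
    have h1 : 4 * Real.pi * d ^ 2 * A * (N : ℝ) ^ ((d : ℝ) + 1 - α) ≤ Q := by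
      refine le_trans ?_ hQA
      have : (0 : ℝ) ≤ (d : ℝ) + 1 - α := by
        have := (Nat.cast_nonneg d : (0 : ℝ) ≤ d); linarith
      gcongr
    calc _ ≤ A * (2 * Real.pi * d ^ 2) * (N : ℝ) ^ (d + 1) * (1 / Q) :=
          mul_le_mul_of_nonneg_left hdist (by positivity)
      _ = (4 * Real.pi * d ^ 2 * A * (N : ℝ) ^ ((d : ℝ) + 1 - α)) * ((N : ℝ) ^ α / 2) / Q := by
          rw [hpow]; ring
      _ ≤ Q * ((N : ℝ) ^ α / 2) / Q := by gcongr
      _ = (N : ℝ) ^ α / 2 := by field_simp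
  have hhalf : (N : ℝ) ^ α / 2 ≤ ‖∑ n ∈ Finset.Ico 1 (1 + N), curveTerm a d n t'‖ := by
    have := norm_sub_norm_le (∑ n ∈ Finset.Ico 1 (1 + N), curveTerm a d n t)
      (∑ n ∈ Finset.Ico 1 (1 + N), curveTerm a d n t')
    linarith
  have hRM := norm_sq_partial_sum_le (fun n => curveTerm a d n t') K 1 N hN
  have hsq : ((N : ℝ) ^ α / 2) ^ 2 ≤ ‖∑ n ∈ Finset.Ico 1 (1 + N), curveTerm a d n t'‖ ^ 2 := by
    gcongr
  -- Passing from `N` to `2 ^ K ≤ 2 * N` costs `4`, and halving before squaring costs another `4`: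
  -- hence the `16` in the threshold.
  have hX : ((2 : ℝ) ^ K) ^ (2 * α) ≤ 4 * ((N : ℝ) ^ α) ^ 2 := by
    calc ((2 : ℝ) ^ K) ^ (2 * α) ≤ (2 * (N : ℝ)) ^ (2 * α) := by gcongr
      _ = ((2 : ℝ) ^ α) ^ 2 * ((N : ℝ) ^ α) ^ 2 := by
          rw [mul_comm 2 α, Real.rpow_mul (by positivity), Real.mul_rpow (by norm_num) hN0.le,
            Real.rpow_two, mul_pow]
      _ ≤ 4 * ((N : ℝ) ^ α) ^ 2 := by
          have : (2 : ℝ) ^ α ≤ 2 := by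
            simpa using Real.rpow_le_rpow_of_exponent_le (by norm_num : (1 : ℝ) ≤ 2) hα1
          have h0 : (0 : ℝ) ≤ (2 : ℝ) ^ α := by positivity
          gcongr
          nlinarith
  rw [div_le_iff₀ (by positivity)]
  nlinarith

/-! ### Dimension of the exceptional parameters -/

/-- The parameters at which the Weyl sum along the moment curve is large infinitely often. -/
noncomputable def exceptionalParameters (a : ℕ → ℂ) (d : ℕ) (α : ℝ) : Set ℝ :=
  {t | t ∈ Set.Ico (0 : ℝ) 1 ∧
    {N : ℕ | (N : ℝ) ^ α ≤ ‖∑ n ∈ Finset.Ico 1 (1 + N), curveTerm a d n t‖}.Infinite}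

theorem dimH_exceptionalParameters_le {d : ℕ} (hd : 0 < d) {a : ℕ → ℂ} (ha : IsSubpolynomial a)
    {α : ℝ} (hα0 : 0 < α) (hα1 : α < 1) {s : NNReal}
    (hs : (d : ℝ) + 2 - 3 * α < s * ((d : ℝ) + 1 - α)) :
    dimH (exceptionalParameters a d α) ≤ s := by
  have hd1 : (1 : ℝ) ≤ d := by exact_mod_cast hd
  set D : ℝ := (d : ℝ) + 1 - α with hD
  -- Three `ε` are lost: two from the squared weight bound, one from enlarging the exponent of `Q`
  -- to absorb the weights.
  obtain ⟨ε, hε0, hε⟩ : ∃ ε : ℝ, 0 < ε ∧ 3 * ε < s * D - ((d : ℝ) + 2 - 3 * α) :=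
    ⟨(s * D - ((d : ℝ) + 2 - 3 * α)) / 4, by linarith, by linarith⟩
  obtain ⟨C, hC1, hC⟩ := ha.exists_const hε0
  set C₁ : ℝ := 4 * Real.pi * d ^ 2 * C with hC₁
  have hC₁1 : 1 ≤ C₁ := by
    have h1 : (1 : ℝ) ≤ (d : ℝ) ^ 2 := one_le_pow₀ hd1
    have h2 : (1 : ℝ) ≤ 4 * Real.pi := by linarith [Real.pi_gt_three]
    exact one_le_mul_of_one_le_of_one_le (one_le_mul_of_one_le_of_one_le h2 h1) hC1
  set X : ℕ → ℝ := fun K => (2 : ℝ) ^ K with hX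
  have hX1 : ∀ K, 1 ≤ X K := fun K => one_le_pow₀ (by norm_num)
  have hX0 : ∀ K, 0 < X K := fun K => zero_lt_one.trans_le (hX1 K)
  set Q : ℕ → ℕ := fun K => ⌈C₁ * X K ^ (D + ε)⌉₊ with hQdef
  have hXD : ∀ K, X K ≤ X K ^ (D + ε) := fun K => by
    simpa using Real.rpow_le_rpow_of_exponent_le (hX1 K) (by linarith : (1 : ℝ) ≤ D + ε)
  have hXp : ∀ K, 0 < X K ^ (D + ε) := fun K => Real.rpow_pos_of_pos (hX0 K) _
  have hQlow : ∀ K, C₁ * X K ^ (D + ε) ≤ Q K := fun K => Nat.le_ceil _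
  have hQlow' : ∀ K, X K ^ (D + ε) ≤ Q K := fun K =>
    (le_mul_of_one_le_left (hXp K).le hC₁1).trans (hQlow K)
  have hQX : ∀ K, 2 ^ K ≤ Q K := fun K => by
    have := (hXD K).trans (hQlow' K)
    simp only [hX] at this
    exact_mod_cast this
  have hQ0 : ∀ K, 0 < Q K := fun K => lt_of_lt_of_le (by positivity) (hQX K)
  have hQup : ∀ K, (Q K : ℝ) ≤ 2 * C₁ * X K ^ (D + ε) := fun K => by
    have h1 := (Nat.ceil_lt_add_one (mul_nonneg (zero_le_one.trans hC₁1) (hXp K).le)).le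
    have h2 : 1 ≤ C₁ * X K ^ (D + ε) :=
      one_le_mul_of_one_le_of_one_le hC₁1 ((hX1 K).trans (hXD K))
    linarith
  have hA : ∀ K n : ℕ, 1 ≤ n → n ≤ 2 ^ K → ‖a n‖ ≤ C * X K ^ ε := fun K n h1 h2 => by
    refine (hC n h1).trans ?_
    have : (n : ℝ) ≤ X K := by simp only [hX]; exact_mod_cast h2
    gcongr
  set lam : ℕ → ℝ := fun K => X K ^ (2 * α) / (16 * ((K : ℝ) + 1)) with hlam
  have hlam0 : ∀ K, 0 < lam K := fun K => by
    have := Real.rpow_pos_of_pos (hX0 K) (2 * α)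
    simp only [hlam]; positivity
  refine dimH_le_of_summable_cover (Q := Q) (G := fun K => largeIntervals a d K (Q K) (lam K)) hQX
    (fun t ht n => ?_) ?_
  -- With `K = Nat.log 2 N + 1` one has `N < 2 ^ K ≤ 2 * N`, and `N > 2 ^ n` gives `K > n`.
  · obtain ⟨N, hNmem, hN⟩ := ht.2.exists_gt (2 ^ n)
    have hN1 : N ≠ 0 := Nat.ne_zero_of_lt hN
    have hlog := Nat.lt_pow_succ_log_self (b := 2) (by norm_num) N
    have hlog' := Nat.pow_log_le_self 2 hN1
    refine ⟨Nat.log 2 N + 1, ?_, exists_mem_largeIntervals (A := C * X (Nat.log 2 N + 1) ^ ε)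
      (mul_nonneg (zero_le_one.trans hC1) (Real.rpow_nonneg (hX0 _).le _)) hα0.le hα1.le (hA _)
      (hQ0 _) ?_ (Nat.one_le_iff_ne_zero.2 hN1) hlog.le ?_ ht.1 hNmem⟩
    · have := Nat.le_log_of_pow_le (b := 2) (by norm_num) hN.le
      omega
    · refine le_trans (le_of_eq ?_) (hQlow _)
      rw [Real.rpow_add (hX0 _)]
      simp only [hC₁, hX]
      ring
    · rw [pow_succ]; omega
  · set e : ℝ := 1 - 2 * α + 2 * ε + (D + ε) * (1 - s) with he
    have he0 : e < 0 := by
      have : e = (d : ℝ) + 2 - 3 * α - s * D + 3 * ε - s * ε := by rw [he, hD]; ring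
      have : 0 ≤ s * ε := mul_nonneg s.coe_nonneg hε0.le
      linarith
    have hr1 : (2 : ℝ) ^ e < 1 := Real.rpow_lt_one_of_one_lt_of_neg (by norm_num) he0
    have hr0 : (0 : ℝ) < 2 ^ e := by positivity
    -- The cube of `K + 1` collects the harmonic sum, the number of dyadic levels and the
    -- Rademacher–Menshov factor. Shifting the index to match `K + 1` accounts for the factor `(2 ^
    -- e)⁻¹` in the majorant.
    have hgeo := (summable_nat_add_iff 1).2 (summable_pow_mul_geometric_of_norm_lt_one 3
      (r := (2 : ℝ) ^ e) (by rwa [Real.norm_of_nonneg hr0.le]))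
    refine Summable.of_nonneg_of_le (fun K => by positivity) (fun K => ?_)
      (hgeo.mul_left (96 * C₁ * C ^ 2 * ((2 : ℝ) ^ e)⁻¹))
    have hcard := card_largeIntervals_mul_le hd (hQ0 K) (hA K) (lam K)
    have hXe : X K ^ e = ((2 : ℝ) ^ e) ^ K := by
      simp only [hX]
      rw [← Real.rpow_natCast, ← Real.rpow_natCast, ← Real.rpow_mul (by norm_num),
        ← Real.rpow_mul (by norm_num), mul_comm]
    have hinv : (1 / (Q K : ℝ)) ^ (s : ℝ) ≤ (X K ^ (D + ε)) ^ (-(s : ℝ)) := by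
      rw [Real.rpow_neg (hXp K).le, ← Real.inv_rpow (hXp K).le, one_div]
      exact Real.rpow_le_rpow (by positivity) (inv_anti₀ (hXp K) (hQlow' K)) s.coe_nonneg
    have hcard' : ((largeIntervals a d K (Q K) (lam K)).card : ℝ) ≤
        96 * C₁ * C ^ 2 * ((K : ℝ) + 1) ^ 3 *
          (X K ^ (D + ε) * (X K * (X K ^ ε) ^ 2 * (X K ^ (2 * α))⁻¹)) := by
      have hXa : 0 < X K ^ (2 * α) := Real.rpow_pos_of_pos (hX0 K) _
      have hXε : 0 < X K ^ ε := Real.rpow_pos_of_pos (hX0 K) _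
      have hXK := hX0 K
      have hXDε := hXp K
      rw [← le_div_iff₀ (hlam0 K)] at hcard
      refine hcard.trans ?_
      calc _ = (Q K : ℝ) * ((C * X K ^ ε) ^ 2 * (3 + 2 * K) * ((K + 1) * X K)) *
            (16 * (K + 1)) * (X K ^ (2 * α))⁻¹ := by
            simp only [hlam]; field_simp; simp only [hX]
        _ ≤ (2 * C₁ * X K ^ (D + ε)) * ((C * X K ^ ε) ^ 2 * (3 * (K + 1)) * ((K + 1) * X K)) *
            (16 * (K + 1)) * (X K ^ (2 * α))⁻¹ := by
            have h1 := hQup K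
            have h2 : (3 : ℝ) + 2 * K ≤ 3 * (K + 1) := by
              linarith [(Nat.cast_nonneg K : (0 : ℝ) ≤ K)]
            gcongr
        _ = _ := by ring
    have hexp : X K ^ (D + ε) * (X K * (X K ^ ε) ^ 2 * (X K ^ (2 * α))⁻¹) *
        (X K ^ (D + ε)) ^ (-(s : ℝ)) = X K ^ e := by
      have h2 : (X K ^ ε) ^ 2 = X K ^ (2 * ε) := by
        rw [← Real.rpow_natCast, ← Real.rpow_mul (hX0 K).le]; congr 1; push_cast; ring
      rw [h2, ← Real.rpow_neg (hX0 K).le, ← Real.rpow_mul (hX0 K).le]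
      nth_rewrite 2 [← Real.rpow_one (X K)]
      rw [← Real.rpow_add (hX0 K), ← Real.rpow_add (hX0 K), ← Real.rpow_add (hX0 K),
        ← Real.rpow_add (hX0 K)]
      congr 1
      rw [he]; ring
    have hpos : 0 ≤ 96 * C₁ * C ^ 2 * ((K : ℝ) + 1) ^ 3 *
          (X K ^ (D + ε) * (X K * (X K ^ ε) ^ 2 * (X K ^ (2 * α))⁻¹)) :=
      le_trans (Nat.cast_nonneg _) hcard'
    refine (mul_le_mul hcard' hinv (by positivity) hpos).trans (le_of_eq ?_)
    rw [mul_assoc, hexp, hXe]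
    push_cast
    rw [pow_succ ((2 : ℝ) ^ e) K]
    field_simp

/-! ### Transfer to the moment curve -/

theorem weylSum_momentCurve (a : ℕ → ℂ) (d : ℕ) (t : ℝ) (N : ℕ) :
    weylSum a d (WithLp.toLp 2 fun j : Fin d => t ^ ((j : ℕ) + 1)) N
      = ∑ n ∈ Finset.Ico 1 (1 + N), curveTerm a d n t := by
  have : Finset.Icc 1 N = Finset.Ico 1 (1 + N) := by ext; simp; omega
  simp only [weylSum, curveTerm, curvePhase, this]

/-- The first coordinate of a curve point is `t`, so membership in the half-open cube excludes `t =
1`. -/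
theorem exceptionalSet_inter_momentCurve_subset {d : ℕ} (hd : 0 < d) (a : ℕ → ℂ) (α : ℝ) :
    exceptionalSet a d α ∩ momentCurve d ⊆
      (fun t : ℝ => WithLp.toLp 2 (fun j : Fin d => t ^ ((j : ℕ) + 1))) ''
        exceptionalParameters a d α := by
  rintro _ ⟨⟨htorus, hinf⟩, t, -, rfl⟩
  refine ⟨t, ⟨by simpa using htorus ⟨0, hd⟩, ?_⟩, rfl⟩
  simpa only [weylSum_momentCurve] using hinf

theorem contDiff_momentCurve (d : ℕ) : ContDiff ℝ 1
    (fun t : ℝ => (WithLp.toLp 2 (fun j : Fin d => t ^ ((j : ℕ) + 1)) : EuclideanSpace ℝ (Fin d))) := by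
  rw [contDiff_euclidean]
  intro j
  simp only
  fun_prop

theorem theorem2p15 (d : ℕ) (hd : 2 ≤ d) (a : ℕ → ℂ) (ha : IsSubpolynomial a)
    (α : ℝ) (hα0 : 0 < α) (hα1 : α < 1) :
    dimH (exceptionalSet a d α ∩ momentCurve d) ≤
      ENNReal.ofReal (1 - (2 * α - 1) / ((d : ℝ) + 1 - α)) := by
  have hd2 : (2 : ℝ) ≤ d := by exact_mod_cast hd
  have hD : 0 < (d : ℝ) + 1 - α := by linarith
  refine (dimH_mono (exceptionalSet_inter_momentCurve_subset (by omega) a α)).trans ?_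
  -- A `C¹` map does not raise Hausdorff dimension.
  refine ((contDiff_momentCurve d).contDiffOn.dimH_image_le convex_univ
    (Set.subset_univ _)).trans ?_
  -- Convergence of the covering series needs `s` strictly above the critical exponent, hence the
  -- `δ`.
  refine ENNReal.le_of_forall_pos_le_add fun δ hδ _ => ?_
  have h := dimH_exceptionalParameters_le (d := d) (by omega) ha hα0 hα1
    (s := Real.toNNReal (1 - (2 * α - 1) / ((d : ℝ) + 1 - α)) + δ) ?_
  · simpa [ENNReal.ofReal] using h
  · have hδ' : (0 : ℝ) < δ := by exact_mod_cast hδ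
    have h1 := Real.le_coe_toNNReal (1 - (2 * α - 1) / ((d : ℝ) + 1 - α))
    have h2 : (1 - (2 * α - 1) / ((d : ℝ) + 1 - α)) * ((d : ℝ) + 1 - α) = (d : ℝ) + 2 - 3 * α := by
      field_simp; ring
    rw [NNReal.coe_add, ← h2]
    exact mul_lt_mul_of_pos_right (by linarith) hD
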